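/- Let $N\ge 3$, let $B_1\subset\mathbb{R}^N$ be the open unit ball, and let $a:[0,1]\to\mathbb{R}$ satisfy (A) $a(|x|)\in C^2(\overline{B_1})$, $a(r)>0$ for $0\le r\le 1$, and $a(0)=1$. A *radial solution* is a pair $(\lambda,u)$ with $\lambda>0$ and $u\in C^2(B_1)\cap C(\overline{B_1})$ radially symmetric such that $$-\Delta u=\lambda a(|x|)e^{u}\ \text{ in } B_1,\qquad u>0\ \text{ in } B_1,\qquad u=0\ \text{ on } \partial B_1 .$$ Then the following hold. 1. For every $\beta\in\mathbb{R}$ the initial value problem $$-\Big(v''+\frac{N-1}{r}v'\Big)=a(r)e^{v}\quad (0<r\le 1),\qquad v(0)=\beta,\quad v'(0)=0,$$ has a unique solution $v(\cdot,\beta)\in C^2([0,1])$. Put $$\lambda(\beta)=e^{v(1,\beta)},\qquad \alpha(\beta)=\beta-\log\lambda(\beta),\qquad u_\beta(x)=v(|x|,\beta)-\log\lambda(\beta)\quad (x\in\overline{B_1}).$$ 2. The set of all radial solutions is exactly $\{(\lambda(\beta),u_\beta):\beta\in\mathbb{R}\}$, and $\|u_\beta\|_{L^\infty(B_1)}=\alpha(\beta)>0$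 for every $\beta\in\mathbb{R}$. 3. The branch $\mathcal{C}=\{(\lambda(\beta),\alpha(\beta)):\beta\in\mathbb{R}\}$ is an unbounded analytic curve emanating from $(0,0)$. That is, $\beta\mapsto(\lambda(\beta),\alpha(\beta))$ is real analytic on $\mathbb{R}$, injective, and has nowhere vanishing derivative; $(\lambda(\beta),\alpha(\beta))\to(0,0)$ as $\beta\to-\infty$; and $\mathcal{C}$ is an unbounded subset of $\mathbb{R}^2$. 4. There exists $0<\lambda^*<\infty$ such that $\lambda(\beta)\le\lambda^*$ for all $\beta\in\mathbb{R}$. -/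

import Mathlib

open MeasureTheory Set Filter Topology Laplacian

/-- The condition (A) on the weight: `x ↦ a(|x|)` is of class `C²` on the closed unit ball of `ℝ^N`
(up to the boundary), `a > 0` on `[0,1]`, and `a(0) = 1`. Only the values of `a` on `[0,1]` matter. -/
structure IsGelfandWeight (N : ℕ) (a : ℝ → ℝ) : Prop where
  contDiffOn : ContDiffOn ℝ 2 (fun x : EuclideanSpace ℝ (Fin N) => a ‖x‖) (Metric.closedBall 0 1)
  pos : ∀ r ∈ Icc (0 : ℝ) 1, 0 < a r
  apply_zero : a 0 = 1

/-- `(lam, u)` is a radial (classical) solution of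
`-Δu = lam a(|x|) e^u` in `B₁`, `u > 0` in `B₁`, `u = 0` on `∂B₁`, with `lam > 0`;
only the values of `u` on the closed unit ball matter. -/
structure IsRadialGelfandSolution (N : ℕ) (a : ℝ → ℝ) (lam : ℝ)
    (u : EuclideanSpace ℝ (Fin N) → ℝ) : Prop where
  lam_pos : 0 < lam
  contDiffOn : ContDiffOn ℝ 2 u (Metric.ball 0 1)
  continuousOn : ContinuousOn u (Metric.closedBall 0 1)
  radial : ∀ x ∈ Metric.closedBall (0 : EuclideanSpace ℝ (Fin N)) 1,
    ∀ y ∈ Metric.closedBall (0 : EuclideanSpace ℝ (Fin N)) 1, ‖x‖ = ‖y‖ → u x = u y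
  equation : ∀ x ∈ Metric.ball (0 : EuclideanSpace ℝ (Fin N)) 1,
    -(Δ u) x = lam * a ‖x‖ * Real.exp (u x)
  pos : ∀ x ∈ Metric.ball (0 : EuclideanSpace ℝ (Fin N)) 1, 0 < u x
  boundary : ∀ x ∈ Metric.sphere (0 : EuclideanSpace ℝ (Fin N)) 1, u x = 0

/-- `v ∈ C²([0,1])` solves the radial initial value problem
`-(v'' + (N-1)/r v') = a(r) e^v` for `0 < r ≤ 1`, `v(0) = β`, `v'(0) = 0`
(derivatives are one-sided at the endpoints of `[0,1]`). -/
structure IsRadialIVPSolution (N : ℕ) (a : ℝ → ℝ) (β : ℝ) (v : ℝ → ℝ) : Prop where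
  contDiffOn : ContDiffOn ℝ 2 v (Icc 0 1)
  equation : ∀ r ∈ Ioc (0 : ℝ) 1,
    -(iteratedDerivWithin 2 v (Icc 0 1) r + ((N : ℝ) - 1) / r * derivWithin v (Icc 0 1) r)
      = a r * Real.exp (v r)
  apply_zero : v 0 = β
  deriv_zero : derivWithin v (Icc 0 1) 0 = 0

/-- `λ(β) = e^{v(1,β)}`, for a family `v β r` of functions of `r`. -/
noncomputable def branchLambda (v : ℝ → ℝ → ℝ) (β : ℝ) : ℝ := Real.exp (v β 1)

/-- `α(β) = β - log λ(β)`. -/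
noncomputable def branchAlpha (v : ℝ → ℝ → ℝ) (β : ℝ) : ℝ := β - Real.log (branchLambda v β)

/-- The function `u(|x|, α(β)) = v(|x|, β) - log λ(β)` on `ℝ^N`. -/
noncomputable def branchFun (N : ℕ) (v : ℝ → ℝ → ℝ) (β : ℝ) (x : EuclideanSpace ℝ (Fin N)) : ℝ :=
  v β ‖x‖ - Real.log (branchLambda v β)

/-- The parametrization `β ↦ (λ(β), α(β))` of the bifurcation curve. -/
noncomputable def branchCurve (v : ℝ → ℝ → ℝ) (β : ℝ) : ℝ × ℝ := (branchLambda v β, branchAlpha v β)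

/-! Write `k = N - 1`. Integrating the radial equation twice turns the initial value problem into
the Volterra equation `v = β - K(a e^v)` on `C([0,1])`, where `K h(r) = ∫₀^r s^(-k) ∫₀^s t^k h(t) dt
ds`. The substitution `t = sτ` writes the inner quotient as `s` times the mean `∫₀¹ τ^k h(sτ) dτ`,
which is continuous at `s = 0`; this removes the singularity at the origin.

Since `a e^v ≥ 0`, every solution satisfies `v ≤ β`, so the exponential may be truncated at `β` and
becomes Lipschitz. Iterated integration gains factorials, some iterate is a contraction, and the
solution exists uniquely on all of `[0,1]` (`existsUnique_eq_sub_radialOp`). The derivative `f ↦ f +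
K(a e^w f)` of `w ↦ w + K(a e^w)` is invertible by the same argument, so the analytic inverse
function theorem gives analyticity in `β` (`analyticAt_volterraSol`).

The function `K h(|x|)` is `C²` on `ℝ^N` with Laplacian `h(|x|)`, so each `v` yields a solution of
the PDE. Conversely, for a radial solution `u` and `h = λ a e^u`, the function `u + K h(|x|)` is
harmonic and constant on the sphere, hence constant by the maximum principle, and `u + log λ` solves
the Volterra equation.

With `m = min a > 0` and `v` decreasing, `-v'(r) ≥ (m/N) r e^{v(r)}`, that is `(e^{-v})' ≥ (m/N) r`;
integration gives `λ = e^{v(1)} ≤ 2N/m`. The identity `α + log λ = β` then makes `α` unbounded, and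
also gives injectivity and a nonvanishing derivative. As `β → -∞`, `0 < λ < e^β` and `0 < α ≤ ‖a‖
e^β`. -/

/-! ### One-variable calculus of the radial potential -/

/-- The weighted mean `∫₀¹ τ^k h(sτ) dτ`. -/
noncomputable def radialMean (k : ℕ) (h : ℝ → ℝ) (s : ℝ) : ℝ :=
  ∫ τ in (0 : ℝ)..1, τ ^ k * h (s * τ)

/-- The potential `∫₀^r s · radialMean k h s ds`, whose radial Laplacian in dimension `k + 1`
is `h`. -/
noncomputable def radialPotential (k : ℕ) (h : ℝ → ℝ) (r : ℝ) : ℝ :=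
  ∫ s in (0 : ℝ)..r, s * radialMean k h s

theorem continuous_radialMean (k : ℕ) {h : ℝ → ℝ} (hh : Continuous h) :
    Continuous (radialMean k h) := by
  unfold radialMean
  apply intervalIntegral.continuous_parametric_intervalIntegral_of_continuous'
  fun_prop

theorem radialMean_zero (k : ℕ) (h : ℝ → ℝ) : radialMean k h 0 = h 0 / (k + 1) := by
  simp only [radialMean, zero_mul, intervalIntegral.integral_mul_const, integral_pow]
  simp; ring

/-- The substitution `t = sτ`; the right-hand side has a variable endpoint and can be differentiated
by the fundamental theorem of calculus. -/
theorem pow_mul_radialMean (k : ℕ) (h : ℝ → ℝ) (s : ℝ) :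
    s ^ (k + 1) * radialMean k h s = ∫ t in (0 : ℝ)..s, t ^ k * h t := by
  have := intervalIntegral.smul_integral_comp_mul_left (a := 0) (b := 1)
    (fun t => t ^ k * h t) s
  simp only [mul_zero, mul_one, smul_eq_mul] at this
  rw [← this, radialMean, pow_succ', mul_assoc, ← intervalIntegral.integral_const_mul]
  simp only [mul_pow, mul_assoc]

theorem hasDerivAt_radialMean (k : ℕ) {h : ℝ → ℝ} (hh : Continuous h) {s : ℝ} (hs : s ≠ 0) :
    HasDerivAt (radialMean k h) ((h s - (k + 1) * radialMean k h s) / s) s := by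
  have h1 : HasDerivAt (fun s => ∫ t in (0 : ℝ)..s, t ^ k * h t) (s ^ k * h s) s := by
    have hc : Continuous fun t : ℝ => t ^ k * h t := by fun_prop
    exact hc.integral_hasStrictDerivAt 0 s |>.hasDerivAt
  have h2 := h1.div (hasDerivAt_pow (k + 1) s) (pow_ne_zero _ hs)
  have h3 : HasDerivAt (fun s => (∫ t in (0 : ℝ)..s, t ^ k * h t) / s ^ (k + 1))
      ((h s - (k + 1) * radialMean k h s) / s) s := by
    convert! h2 using 1
    rw [← pow_mul_radialMean]
    push_cast
    field_simp
    ring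
  refine h3.congr_of_eventuallyEq ?_
  filter_upwards [isOpen_ne.mem_nhds hs] with t ht
  rw [← pow_mul_radialMean]
  field_simp [show t ≠ 0 from ht]

/-- Unlike the derivative of the mean itself, this one has no singularity at `0`: there the slope is
`radialMean k h 0 = h 0 / (k + 1)`, which agrees with the formula. This makes the potential `C²`
across the origin. -/
theorem hasDerivAt_mul_radialMean (k : ℕ) {h : ℝ → ℝ} (hh : Continuous h) (s : ℝ) :
    HasDerivAt (fun s => s * radialMean k h s) (h s - k * radialMean k h s) s := by
  rcases eq_or_ne s 0 with rfl | hs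
  · have : h 0 - k * radialMean k h 0 = radialMean k h 0 := by
      rw [radialMean_zero]; field_simp; ring
    rw [this, hasDerivAt_iff_tendsto_slope]
    have h1 : Tendsto (radialMean k h) (𝓝[≠] 0) (𝓝 (radialMean k h 0)) :=
      (continuous_radialMean k hh).continuousAt.tendsto.mono_left nhdsWithin_le_nhds
    refine h1.congr' ?_
    filter_upwards [self_mem_nhdsWithin] with t ht
    have ht : t ≠ 0 := ht
    simp [slope_def_field]
    field_simp
  · convert! (hasDerivAt_id' s).mul (hasDerivAt_radialMean k hh hs) using 1
    field_simp; ring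

theorem hasDerivAt_radialPotential (k : ℕ) {h : ℝ → ℝ} (hh : Continuous h) (r : ℝ) :
    HasDerivAt (radialPotential k h) (r * radialMean k h r) r := by
  have hc : Continuous fun s : ℝ => s * radialMean k h s :=
    continuous_id.mul (continuous_radialMean k hh)
  exact hc.integral_hasStrictDerivAt 0 r |>.hasDerivAt

theorem deriv_radialPotential (k : ℕ) {h : ℝ → ℝ} (hh : Continuous h) :
    deriv (radialPotential k h) = fun r => r * radialMean k h r :=
  funext fun r => (hasDerivAt_radialPotential k hh r).deriv

theorem deriv_deriv_radialPotential (k : ℕ) {h : ℝ → ℝ} (hh : Continuous h) :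
    deriv (deriv (radialPotential k h)) = fun r => h r - k * radialMean k h r := by
  rw [deriv_radialPotential k hh]
  exact funext fun r => (hasDerivAt_mul_radialMean k hh r).deriv

theorem contDiff_radialPotential (k : ℕ) {h : ℝ → ℝ} (hh : Continuous h) :
    ContDiff ℝ 2 (radialPotential k h) := by
  rw [show (2 : WithTop ℕ∞) = 1 + 1 by norm_num, contDiff_succ_iff_deriv]
  refine ⟨fun r => (hasDerivAt_radialPotential k hh r).differentiableAt, by simp, ?_⟩
  rw [contDiff_one_iff_deriv, deriv_deriv_radialPotential k hh, deriv_radialPotential k hh]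
  refine ⟨fun r => (hasDerivAt_mul_radialMean k hh r).differentiableAt, ?_⟩
  exact hh.sub (continuous_const.mul (continuous_radialMean k hh))

@[simp] theorem radialPotential_zero (k : ℕ) (h : ℝ → ℝ) : radialPotential k h 0 = 0 := by
  simp [radialPotential]

theorem abs_radialMean_le (k : ℕ) {h : ℝ → ℝ} {s M : ℝ} (hs : 0 ≤ s)
    (hM : ∀ t ∈ Icc 0 s, |h t| ≤ M) : |radialMean k h s| ≤ M := by
  have := intervalIntegral.norm_integral_le_of_norm_le_const (a := (0 : ℝ)) (b := 1) (C := M)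
    (f := fun τ => τ ^ k * h (s * τ)) ?_
  · simpa [radialMean] using this
  · intro τ hτ
    rw [uIoc_of_le zero_le_one] at hτ
    have h1 : |h (s * τ)| ≤ M := hM _ ⟨mul_nonneg hs hτ.1.le, mul_le_of_le_one_right hs hτ.2⟩
    rw [Real.norm_eq_abs, abs_mul, abs_of_nonneg (pow_nonneg hτ.1.le k)]
    exact (mul_le_of_le_one_left (abs_nonneg _) (pow_le_one₀ hτ.1.le hτ.2)).trans h1

theorem radialMean_mono_left {k : ℕ} {h g : ℝ → ℝ} (hh : Continuous h) (hg : Continuous g) {s : ℝ}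
    (hs : 0 ≤ s) (hM : ∀ t ∈ Icc 0 s, g t ≤ h t) : radialMean k g s ≤ radialMean k h s := by
  refine intervalIntegral.integral_mono_on zero_le_one
    (Continuous.intervalIntegrable (by fun_prop) _ _)
    (Continuous.intervalIntegrable (by fun_prop) _ _) ?_
  intro τ hτ
  exact mul_le_mul_of_nonneg_left
    (hM _ ⟨mul_nonneg hs hτ.1, mul_le_of_le_one_right hs hτ.2⟩) (pow_nonneg hτ.1 k)

theorem radialMean_const (k : ℕ) (c s : ℝ) : radialMean k (fun _ => c) s = c / (k + 1) := by
  simp only [radialMean, intervalIntegral.integral_mul_const, integral_pow]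
  simp; ring

theorem radialPotential_nonneg (k : ℕ) {h : ℝ → ℝ} (hh : Continuous h) {r : ℝ} (hr : 0 ≤ r)
    (hM : ∀ t ∈ Icc 0 r, 0 ≤ h t) : 0 ≤ radialPotential k h r := by
  refine intervalIntegral.integral_nonneg hr fun s hs => mul_nonneg hs.1 ?_
  have := radialMean_mono_left (k := k) hh continuous_const hs.1
    fun t ht => hM t ⟨ht.1, ht.2.trans hs.2⟩
  simpa [radialMean_const] using this

/-- The mean is bounded by the supremum over `[0,s]` and the factor `s ≤ 1` is discarded; the
remaining outer integration supplies the factor `r / (m + 1)` that builds up the factorial. -/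
theorem abs_radialPotential_le (k m : ℕ) {h : ℝ → ℝ} {r C : ℝ}
    (hr : 0 ≤ r) (hr1 : r ≤ 1) (hC : 0 ≤ C)
    (hM : ∀ t ∈ Icc 0 r, |h t| ≤ C * (t ^ m / m.factorial)) :
    |radialPotential k h r| ≤ C * (r ^ (m + 1) / (m + 1).factorial) := by
  have h1 : |radialPotential k h r| ≤ ∫ s in (0 : ℝ)..r, C * (s ^ m / m.factorial) := by
    rw [← Real.norm_eq_abs]
    refine intervalIntegral.norm_integral_le_of_norm_le hr ?_
      (Continuous.intervalIntegrable (by fun_prop) _ _)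
    refine Eventually.of_forall fun s hs => ?_
    rw [Real.norm_eq_abs, abs_mul, abs_of_pos hs.1]
    refine (mul_le_of_le_one_left (abs_nonneg _) (hs.2.trans hr1)).trans ?_
    refine abs_radialMean_le k hs.1.le fun t ht => (hM t ⟨ht.1, ht.2.trans hs.2⟩).trans ?_
    have := pow_le_pow_left₀ ht.1 ht.2 m
    gcongr
  refine h1.trans (le_of_eq ?_)
  simp only [intervalIntegral.integral_const_mul, intervalIntegral.integral_div, integral_pow,
    Nat.factorial_succ]
  have : (m.factorial : ℝ) ≠ 0 := by positivity
  push_cast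
  field_simp
  simp

theorem radialMean_add {k : ℕ} {h g : ℝ → ℝ} (hh : Continuous h) (hg : Continuous g) (s : ℝ) :
    radialMean k (fun t => h t + g t) s = radialMean k h s + radialMean k g s := by
  unfold radialMean
  rw [← intervalIntegral.integral_add (Continuous.intervalIntegrable (by fun_prop) _ _)
    (Continuous.intervalIntegrable (by fun_prop) _ _)]
  simp only [mul_add]

theorem radialMean_const_mul (k : ℕ) (c : ℝ) (h : ℝ → ℝ) (s : ℝ) :
    radialMean k (fun t => c * h t) s = c * radialMean k h s := by
  unfold radialMean
  rw [← intervalIntegral.integral_const_mul]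
  congr 1; ext; ring

theorem radialPotential_add {k : ℕ} {h g : ℝ → ℝ} (hh : Continuous h) (hg : Continuous g) (r : ℝ) :
    radialPotential k (fun t => h t + g t) r = radialPotential k h r + radialPotential k g r := by
  have h1 := continuous_radialMean k hh
  have h2 := continuous_radialMean k hg
  unfold radialPotential
  rw [← intervalIntegral.integral_add (Continuous.intervalIntegrable (by fun_prop) _ _)
    (Continuous.intervalIntegrable (by fun_prop) _ _)]
  simp only [radialMean_add hh hg, mul_add]

theorem radialPotential_const_mul (k : ℕ) (c : ℝ) (h : ℝ → ℝ) (r : ℝ) :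
    radialPotential k (fun t => c * h t) r = c * radialPotential k h r := by
  unfold radialPotential
  rw [← intervalIntegral.integral_const_mul]
  simp only [radialMean_const_mul]
  congr 1; ext; ring

/-! ### The potential as a function on Euclidean space -/

section RadialLaplacian

variable {F : Type*} [NormedAddCommGroup F] [InnerProductSpace ℝ F]

theorem hasFDerivAt_norm_of_ne_zero {x : F} (hx : x ≠ 0) :
    HasFDerivAt (fun y : F => ‖y‖) (‖x‖⁻¹ • innerSL ℝ x) x := by
  have h := (hasStrictFDerivAt_norm_sq x).hasFDerivAt.sqrt (by simpa using hx)
  simp only [Real.sqrt_sq (norm_nonneg _)] at h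
  convert! h using 1
  ext y
  simp
  ring

/-- The factor `‖x‖` in the derivative of the potential cancels the `‖x‖⁻¹` from the norm. At the
origin, where the norm is not differentiable, the potential is `o(r)`. -/
theorem hasFDerivAt_radialPotential_norm (k : ℕ) {h : ℝ → ℝ} (hh : Continuous h) (x : F) :
    HasFDerivAt (fun y : F => radialPotential k h ‖y‖) (radialMean k h ‖x‖ • innerSL ℝ x) x := by
  rcases eq_or_ne x 0 with rfl | hx
  · have h0 := hasDerivAt_radialPotential k hh 0
    simp only [zero_mul, hasDerivAt_iff_isLittleO_nhds_zero, zero_add, radialPotential_zero,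
      sub_zero, smul_zero] at h0
    have h1 := h0.comp_tendsto (tendsto_norm_zero (E := F))
    rw [hasFDerivAt_iff_isLittleO_nhds_zero]
    simpa [Function.comp_def] using h1.of_norm_right
  · convert! (hasDerivAt_radialPotential k hh ‖x‖).comp_hasFDerivAt x
      (hasFDerivAt_norm_of_ne_zero hx) using 1
    have : ‖x‖ ≠ 0 := norm_ne_zero_iff.2 hx
    rw [smul_smul]
    congr 1
    field_simp

/-- The derivative at `x` of `x ↦ radialMean k h ‖x‖ • x`. -/
noncomputable def radialHessian (k : ℕ) (h : ℝ → ℝ) (x : F) : F →L[ℝ] F :=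
  radialMean k h ‖x‖ • ContinuousLinearMap.id ℝ F +
    ((h ‖x‖ - (k + 1) * radialMean k h ‖x‖) / ‖x‖ ^ 2) • (innerSL ℝ x).smulRight x

theorem hasFDerivAt_radialMean_smul (k : ℕ) {h : ℝ → ℝ} (hh : Continuous h) (x : F) :
    HasFDerivAt (fun y : F => radialMean k h ‖y‖ • y) (radialHessian k h x) x := by
  rcases eq_or_ne x 0 with rfl | hx
  · have h0 : Tendsto (fun y : F => radialMean k h ‖y‖ - radialMean k h 0) (𝓝 0) (𝓝 0) := by
      have hc : Continuous fun y : F => radialMean k h ‖y‖ - radialMean k h 0 :=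
        ((continuous_radialMean k hh).comp continuous_norm).sub continuous_const
      simpa using hc.tendsto 0
    rw [hasFDerivAt_iff_isLittleO_nhds_zero]
    have h1 := ((Asymptotics.isLittleO_one_iff ℝ).2 h0).smul_isBigO
      (Asymptotics.isBigO_refl (fun y : F => y) (𝓝 0))
    simpa [radialHessian, sub_smul] using h1
  · convert! ((hasDerivAt_radialMean k hh (norm_ne_zero_iff.2 hx)).comp_hasFDerivAt x
      (hasFDerivAt_norm_of_ne_zero hx)).smul (hasFDerivAt_id x) using 1
    have : ‖x‖ ≠ 0 := norm_ne_zero_iff.2 hx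
    ext y
    simp only [radialHessian, add_apply, _root_.smul_apply,
      ContinuousLinearMap.smulRight_apply, smul_smul, Function.comp_def, smul_eq_mul,
      ContinuousLinearMap.id_apply, id]
    congr 2
    field_simp

/-- At the origin the rank-one term tends to `0`: its norm away from `0` is `|h - (k + 1) *
radialMean k h|` at `‖x‖`, and this vanishes in the limit because the mean at `0` is `h 0 / (k +
1)`. -/
theorem continuous_radialHessian (k : ℕ) {h : ℝ → ℝ} (hh : Continuous h) :
    Continuous (radialHessian k h : F → F →L[ℝ] F) := by
  have hB : Continuous fun x : F => radialMean k h ‖x‖ :=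
    (continuous_radialMean k hh).comp continuous_norm
  have hd : Continuous fun x : F => h ‖x‖ - (k + 1) * radialMean k h ‖x‖ := by fun_prop
  refine (hB.smul continuous_const).add ?_
  have hR : Continuous fun x : F => (innerSL ℝ x).smulRight x := by
    have h1 := (ContinuousLinearMap.smulRightL ℝ F F).continuous₂
    exact h1.comp ((innerSL ℝ (E := F)).continuous.prodMk continuous_id)
  rw [continuous_iff_continuousAt]
  intro x
  rcases eq_or_ne x 0 with rfl | hx
  · have hd0 : Tendsto (fun x : F => h ‖x‖ - (k + 1) * radialMean k h ‖x‖) (𝓝 0) (𝓝 0) := by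
      have := hd.tendsto 0
      rw [norm_zero, radialMean_zero] at this
      convert this using 2
      field_simp; ring
    unfold ContinuousAt
    simp only [norm_zero, smul_zero, ContinuousLinearMap.smulRight_zero]
    refine squeeze_zero_norm (fun y => ?_) (tendsto_norm_zero.comp hd0)
    rw [Function.comp_apply]
    rw [norm_smul, norm_div, ContinuousLinearMap.norm_smulRight_apply, innerSL_apply_norm]
    rcases eq_or_ne y 0 with rfl | hy
    · simp
    · have : ‖y‖ ≠ 0 := norm_ne_zero_iff.2 hy
      rw [norm_pow, norm_norm]
      apply le_of_eq
      field_simp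
  · exact ((hd.continuousAt.div (by fun_prop) (by simpa using hx)).smul hR.continuousAt)

theorem fderiv_radialPotential_norm (k : ℕ) {h : ℝ → ℝ} (hh : Continuous h) :
    fderiv ℝ (fun y : F => radialPotential k h ‖y‖) =
      fun x => innerSL ℝ (radialMean k h ‖x‖ • x) := by
  ext1 x
  rw [(hasFDerivAt_radialPotential_norm k hh x).fderiv, map_smul]

theorem hasFDerivAt_fderiv_radialPotential_norm (k : ℕ) {h : ℝ → ℝ} (hh : Continuous h) (x : F) :
    HasFDerivAt (fderiv ℝ (fun y : F => radialPotential k h ‖y‖))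
      ((innerSL ℝ (E := F)).comp (radialHessian k h x)) x := by
  rw [fderiv_radialPotential_norm k hh]
  exact (innerSL ℝ (E := F)).hasFDerivAt.comp x (hasFDerivAt_radialMean_smul k hh x)

theorem contDiff_radialPotential_norm (k : ℕ) {h : ℝ → ℝ} (hh : Continuous h) :
    ContDiff ℝ 2 (fun y : F => radialPotential k h ‖y‖) := by
  rw [show (2 : WithTop ℕ∞) = 1 + 1 by norm_num, contDiff_succ_iff_fderiv]
  refine ⟨fun x => (hasFDerivAt_radialPotential_norm k hh x).differentiableAt, by simp, ?_⟩
  rw [contDiff_one_iff_hasFDerivAt]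
  refine ⟨_, ?_, hasFDerivAt_fderiv_radialPotential_norm k hh⟩
  have h1 := (innerSL ℝ (E := F)).continuous
  have h2 := continuous_radialHessian (F := F) k hh
  exact ((ContinuousLinearMap.compL ℝ F F (F →L[ℝ] ℝ)) (innerSL ℝ)).continuous.comp h2

/-- The Laplacian is the trace of `radialHessian`: the identity part contributes `k + 1` times the
mean, which the rank-one part cancels, leaving `h`. -/
theorem laplacian_radialPotential_norm [FiniteDimensional ℝ F] {k : ℕ}
    (hk : Module.finrank ℝ F = k + 1) {h : ℝ → ℝ} (hh : Continuous h) (x : F) :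
    (Δ (fun y : F => radialPotential k h ‖y‖)) x = h ‖x‖ := by
  rw [InnerProductSpace.laplacian_eq_iteratedFDeriv_stdOrthonormalBasis]
  simp only [iteratedFDeriv_two_apply, (hasFDerivAt_fderiv_radialPotential_norm k hh x).fderiv]
  simp only [radialHessian, Matrix.cons_val_zero, Matrix.cons_val_one,
    ContinuousLinearMap.comp_apply, add_apply,
    smul_apply, ContinuousLinearMap.smulRight_apply,
    ContinuousLinearMap.id_apply, map_add, map_smul, innerSL_apply_apply, smul_eq_mul,
    Finset.sum_add_distrib, ← Finset.mul_sum, real_inner_self_eq_norm_sq,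
    OrthonormalBasis.norm_eq_one]
  have h1 : ∑ i, inner ℝ x (stdOrthonormalBasis ℝ F i) * inner ℝ x (stdOrthonormalBasis ℝ F i)
      = ‖x‖ ^ 2 := by
    rw [← real_inner_self_eq_norm_sq, ← (stdOrthonormalBasis ℝ F).sum_inner_mul_inner x x]
    exact Finset.sum_congr rfl fun i _ => by rw [real_inner_comm x]
  rw [h1]
  simp only [one_pow, Finset.sum_const, Finset.card_univ, Fintype.card_fin, hk, nsmul_eq_mul]
  rcases eq_or_ne x 0 with rfl | hx
  · rw [norm_zero, radialMean_zero]
    push_cast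
    field_simp
    simp
  · have : ‖x‖ ≠ 0 := norm_ne_zero_iff.2 hx
    push_cast
    field_simp
    ring

end RadialLaplacian

/-! ### Weak maximum principle on the ball -/

section MaximumPrinciple

variable {F : Type*} [NormedAddCommGroup F] [InnerProductSpace ℝ F]

/-- A positive second derivative would make the point a local minimum as well, so `f` would be
locally constant with zero second derivative. -/
theorem deriv_deriv_nonpos_of_isLocalMax {f : ℝ → ℝ} {t : ℝ} (hm : IsLocalMax f t)
    (hc : ContinuousAt f t) : deriv (deriv f) t ≤ 0 := by
  by_contra! h
  have hmin := isLocalMin_of_deriv_deriv_pos h hm.deriv_eq_zero hc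
  have h1 : f =ᶠ[𝓝 t] fun _ => f t := by
    filter_upwards [hm, hmin] with s h1 h2 using le_antisymm h1 h2
  have h2 := h1.deriv.deriv_eq
  simp at h2
  linarith

theorem laplacian_nonpos_of_isLocalMax [FiniteDimensional ℝ F] {f : F → ℝ} {x : F}
    (hf : ContDiffAt ℝ 2 f x) (hm : IsLocalMax f x) : (Δ f) x ≤ 0 := by
  rw [InnerProductSpace.laplacian_eq_iteratedFDeriv_stdOrthonormalBasis]
  refine Finset.sum_nonpos fun i _ => ?_
  generalize stdOrthonormalBasis ℝ F i = e
  rw [iteratedFDeriv_two_apply]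
  simp only [Matrix.cons_val_zero, Matrix.cons_val_one]
  have hl : ∀ t : ℝ, HasDerivAt (fun t : ℝ => x + t • e) e t := fun t => by
    simpa using ((hasDerivAt_id t).smul_const e).const_add x
  have hl0 : Tendsto (fun t : ℝ => x + t • e) (𝓝 0) (𝓝 x) := by
    simpa using (hl 0).continuousAt.tendsto
  have h1 : deriv (fun t : ℝ => f (x + t • e)) =ᶠ[𝓝 0] fun t => fderiv ℝ f (x + t • e) e := by
    have : ∀ᶠ y in 𝓝 x, DifferentiableAt ℝ f y :=
      (hf.eventually (by simp)).mono fun y hy => hy.differentiableAt (by simp)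
    filter_upwards [hl0.eventually this] with t ht
    exact (ht.hasFDerivAt.comp_hasDerivAt t (hl t)).deriv
  have h2 : deriv (deriv fun t : ℝ => f (x + t • e)) 0 = fderiv ℝ (fderiv ℝ f) x e e := by
    rw [h1.deriv_eq]
    have hd : DifferentiableAt ℝ (fderiv ℝ f) x :=
      (hf.fderiv_right (m := 1) (by norm_num)).differentiableAt (by simp)
    have hd' : HasFDerivAt (fderiv ℝ f) (fderiv ℝ (fderiv ℝ f) x) (x + (0 : ℝ) • e) := by
      simpa using hd.hasFDerivAt
    have h3 : HasDerivAt (fun t : ℝ => fderiv ℝ f (x + t • e)) (fderiv ℝ (fderiv ℝ f) x e) 0 :=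
      hd'.comp_hasDerivAt (0 : ℝ) (hl 0)
    have h4 := h3.clm_apply (hasDerivAt_const (0 : ℝ) e)
    rw [map_zero, add_zero] at h4
    exact h4.deriv
  rw [← h2]
  refine deriv_deriv_nonpos_of_isLocalMax ?_ ?_
  · have := hl0.eventually hm
    simpa [IsLocalMax, IsMaxFilter] using this
  · have : ContinuousAt f (x + (0 : ℝ) • e) := by simpa using hf.continuousAt
    exact this.comp (f := fun t : ℝ => x + t • e) (hl 0).continuousAt

theorem laplacian_norm_sq [FiniteDimensional ℝ F] (x : F) :
    (Δ (fun y : F => ‖y‖ ^ 2)) x = 2 * (Module.finrank ℝ F : ℝ) := by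
  rw [InnerProductSpace.laplacian_eq_iteratedFDeriv_stdOrthonormalBasis]
  simp only [iteratedFDeriv_two_apply, fderiv_norm_sq]
  have : fderiv ℝ (2 • ⇑(innerSL ℝ (E := F))) x = 2 • innerSL ℝ (E := F) :=
    (2 • innerSL ℝ (E := F)).fderiv
  rw [this]
  simp [innerSL_apply_apply ℝ, mul_comm]

/-- Weak maximum principle on the unit ball for functions constant on the sphere. -/
theorem le_of_laplacian_nonneg_ball [FiniteDimensional ℝ F] [Nontrivial F] {w : F → ℝ} {c : ℝ}
    (hc : ContinuousOn w (Metric.closedBall 0 1)) (hd : ContDiffOn ℝ 2 w (Metric.ball 0 1))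
    (hl : ∀ x ∈ Metric.ball (0 : F) 1, 0 ≤ (Δ w) x)
    (hb : ∀ x ∈ Metric.sphere (0 : F) 1, w x ≤ c) {x : F} (hx : x ∈ Metric.closedBall 0 1) :
    w x ≤ c := by
  refine le_of_forall_pos_le_add fun ε hε => ?_
  -- The perturbation `ε‖y‖²` makes the Laplacian strictly positive, which excludes an interior
  -- maximum, and costs only `ε` on the sphere.
  obtain ⟨y, hy, hmax⟩ := (isCompact_closedBall (0 : F) 1).exists_isMaxOn ⟨x, hx⟩
    (f := fun y => w y + ε * ‖y‖ ^ 2) (hc.add (by fun_prop))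
  have hwx : w x ≤ w y + ε * ‖y‖ ^ 2 := by
    have h1 : w x + ε * ‖x‖ ^ 2 ≤ w y + ε * ‖y‖ ^ 2 := hmax hx
    have h2 : 0 ≤ ε * ‖x‖ ^ 2 := by positivity
    linarith
  rcases (mem_closedBall_zero_iff.1 hy).lt_or_eq with h | h
  · exfalso
    have hyb : y ∈ Metric.ball (0 : F) 1 := mem_ball_zero_iff.2 h
    have hn : Metric.ball (0 : F) 1 ∈ 𝓝 y := Metric.isOpen_ball.mem_nhds hyb
    have hwd : ContDiffAt ℝ 2 w y := hd.contDiffAt hn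
    have hsq : ContDiffAt ℝ 2 (fun y : F => ‖y‖ ^ 2) y := (contDiff_norm_sq ℝ).contDiffAt
    have hsq' : ContDiffAt ℝ 2 (ε • fun y : F => ‖y‖ ^ 2) y := hsq.const_smul ε
    have hloc : IsLocalMax (w + ε • fun y : F => ‖y‖ ^ 2) y := by
      filter_upwards [hn] with z hz
      exact hmax (Metric.ball_subset_closedBall hz)
    have h1 : (Δ (w + ε • fun y : F => ‖y‖ ^ 2)) y ≤ 0 :=
      laplacian_nonpos_of_isLocalMax (hwd.add hsq') hloc
    rw [hwd.laplacian_add hsq', InnerProductSpace.laplacian_smul ε hsq, laplacian_norm_sq] at h1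
    have h2 : (0 : ℝ) < Module.finrank ℝ F := by exact_mod_cast Module.finrank_pos
    have h3 := hl y hyb
    simp only [smul_eq_mul] at h1
    have : 0 < ε * (2 * (Module.finrank ℝ F : ℝ)) := by positivity
    linarith
  · have := hb y (mem_sphere_zero_iff_norm.2 h)
    rw [h] at hwx
    linarith

end MaximumPrinciple

/-! ### Volterra equations on `C([0,1])` -/

/-- Extension of a continuous function on `[0,1]` to `ℝ` by constants. -/
noncomputable def unitExtend (f : C(Icc (0 : ℝ) 1, ℝ)) : ℝ → ℝ := IccExtend zero_le_one f

@[fun_prop] theorem continuous_unitExtend (f : C(Icc (0 : ℝ) 1, ℝ)) :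
    Continuous (unitExtend f) := f.continuous.Icc_extend'

theorem unitExtend_of_mem (f : C(Icc (0 : ℝ) 1, ℝ)) {r : ℝ} (hr : r ∈ Icc (0 : ℝ) 1) :
    unitExtend f r = f ⟨r, hr⟩ := IccExtend_of_mem _ _ hr

theorem abs_unitExtend_le (f : C(Icc (0 : ℝ) 1, ℝ)) (r : ℝ) : |unitExtend f r| ≤ ‖f‖ :=
  f.norm_coe_le_norm _

/-- The radial potential as a continuous linear operator on `C([0,1])`. -/
noncomputable def radialOp (k : ℕ) : C(Icc (0 : ℝ) 1, ℝ) →L[ℝ] C(Icc (0 : ℝ) 1, ℝ) :=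
  LinearMap.mkContinuous
    { toFun := fun f => ⟨fun r => radialPotential k (unitExtend f) r,
        (contDiff_radialPotential k (continuous_unitExtend f)).continuous.comp
          continuous_subtype_val⟩
      map_add' := fun f g => by
        ext r
        exact radialPotential_add (continuous_unitExtend f) (continuous_unitExtend g) r
      map_smul' := fun c f => by
        ext r
        exact radialPotential_const_mul k c (unitExtend f) r } 1 <| fun f => by
    rw [one_mul, ContinuousMap.norm_le _ (norm_nonneg f)]
    intro r
    have := abs_radialPotential_le k 0 (h := unitExtend f) r.2.1 r.2.2 (norm_nonneg f)
      (fun t _ => by simpa using abs_unitExtend_le f t)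
    simp only [zero_add, pow_one, Nat.factorial_one, Nat.cast_one, div_one] at this
    exact this.trans (mul_le_of_le_one_right (norm_nonneg f) r.2.2)

theorem abs_radialOp_apply_le (k m : ℕ) {f : C(Icc (0 : ℝ) 1, ℝ)} {C : ℝ} (hC : 0 ≤ C)
    (hM : ∀ t : Icc (0 : ℝ) 1, |f t| ≤ C * ((t : ℝ) ^ m / m.factorial)) (r : Icc (0 : ℝ) 1) :
    |radialOp k f r| ≤ C * ((r : ℝ) ^ (m + 1) / (m + 1).factorial) := by
  refine abs_radialPotential_le k m r.2.1 r.2.2 hC fun t ht => ?_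
  have ht' : t ∈ Icc (0 : ℝ) 1 := ⟨ht.1, ht.2.trans r.2.2⟩
  rw [unitExtend_of_mem f ht']
  exact hM ⟨t, ht'⟩

/-- Unique solvability of Volterra equations `f = b - radialOp k (G f)` with pointwise Lipschitz
nonlinearity `G`. -/
theorem existsUnique_eq_sub_radialOp (k : ℕ) (b : C(Icc (0 : ℝ) 1, ℝ))
    (G : C(Icc (0 : ℝ) 1, ℝ) → C(Icc (0 : ℝ) 1, ℝ)) {C : ℝ} (hC : 0 ≤ C)
    (hG : ∀ f g r, |G f r - G g r| ≤ C * |f r - g r|) :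
    ∃! f, f = b - radialOp k (G f) := by
  set S : C(Icc (0 : ℝ) 1, ℝ) → C(Icc (0 : ℝ) 1, ℝ) := fun f => b - radialOp k (G f) with hS
  -- Each application of `S` adds one integration, hence the factor `r ^ m / m!`. Since `C ^ m / m!`
  -- tends to `0`, some iterate is a contraction, and its fixed point is the unique fixed point of
  -- `S`.
  have hit : ∀ (m : ℕ) f g (r : Icc (0 : ℝ) 1),
      |(S^[m] f) r - (S^[m] g) r| ≤ C ^ m * ‖f - g‖ * ((r : ℝ) ^ m / m.factorial) := by
    intro m f g
    induction m with
    | zero =>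
      intro r
      simpa using (f - g).norm_coe_le_norm r
    | succ m ih =>
      intro r
      rw [Function.iterate_succ_apply', Function.iterate_succ_apply']
      have h1 : (S (S^[m] f)) r - (S (S^[m] g)) r =
          - radialOp k (G (S^[m] f) - G (S^[m] g)) r := by
        simp [hS]
      rw [h1, abs_neg]
      refine abs_radialOp_apply_le k m (by positivity) (fun t => ?_) r
      refine (hG _ _ t).trans ?_
      rw [pow_succ', mul_assoc, mul_assoc]
      refine mul_le_mul_of_nonneg_left ?_ hC
      simpa [mul_assoc] using ih t
  obtain ⟨m, hm⟩ := ((FloorSemiring.tendsto_pow_div_factorial_atTop C).eventually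
    (gt_mem_nhds (show (0 : ℝ) < 1 from one_pos))).exists
  have hK : 0 ≤ C ^ m / m.factorial := by positivity
  have hcon : ContractingWith (NNReal.mk (C ^ m / m.factorial) hK) S^[m] := by
    refine ⟨by exact_mod_cast hm, LipschitzWith.of_dist_le_mul fun f g => ?_⟩
    rw [dist_eq_norm, dist_eq_norm, NNReal.coe_mk, ContinuousMap.norm_le _ (by positivity)]
    intro r
    refine (hit m f g r).trans ?_
    have : (r : ℝ) ^ m ≤ 1 := pow_le_one₀ r.2.1 r.2.2
    calc C ^ m * ‖f - g‖ * ((r : ℝ) ^ m / m.factorial)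
        ≤ C ^ m * ‖f - g‖ * (1 / m.factorial) := by gcongr
      _ = _ := by ring
  refine ⟨ContractingWith.fixedPoint _ hcon, ?_, ?_⟩
  · exact (hcon.isFixedPt_fixedPoint_iterate).symm
  · intro f hf
    exact hcon.fixedPoint_unique (Function.IsFixedPt.iterate (f := S) hf.symm m)

theorem radialOp_nonneg (k : ℕ) {f : C(Icc (0 : ℝ) 1, ℝ)} (hf : 0 ≤ f) : 0 ≤ radialOp k f :=
  fun r => radialPotential_nonneg k (continuous_unitExtend f) r.2.1 fun _ _ => hf _

/-! ### The exponential equation and its unique solution -/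

/-- Composition with the exponential. -/
noncomputable def expComp (f : C(Icc (0 : ℝ) 1, ℝ)) : C(Icc (0 : ℝ) 1, ℝ) :=
  ⟨fun r => Real.exp (f r), by fun_prop⟩

@[simp] theorem expComp_apply (f : C(Icc (0 : ℝ) 1, ℝ)) (r : Icc (0 : ℝ) 1) :
    expComp f r = Real.exp (f r) := rfl

theorem expComp_eq_exp (f : C(Icc (0 : ℝ) 1, ℝ)) : expComp f = NormedSpace.exp f := by
  ext r
  have h := NormedSpace.map_exp (ContinuousMap.evalAlgHom ℝ ℝ r)
    (continuous_eval_const r) f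
  rw [expComp_apply, Real.exp_eq_exp_ℝ]
  exact h.symm

/-- Truncation at `c` makes the exponential globally Lipschitz: for `u ≤ v ≤ c`, `e^v - e^u = e^v (1
- e^(u-v)) ≤ e^c (v - u)`. -/
theorem abs_exp_min_sub_le (x y c : ℝ) :
    |Real.exp (min x c) - Real.exp (min y c)| ≤ Real.exp c * |x - y| := by
  have h1 : ∀ u v : ℝ, u ≤ v → v ≤ c → Real.exp v - Real.exp u ≤ Real.exp c * (v - u) := by
    intro u v huv hv
    have h2 : Real.exp u = Real.exp v * Real.exp (u - v) := by rw [← Real.exp_add]; ring_nf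
    have h3 := Real.add_one_le_exp (u - v)
    have h4 : Real.exp v ≤ Real.exp c := Real.exp_le_exp.2 hv
    have h5 := Real.exp_pos v
    nlinarith
  have h6 : ∀ x y : ℝ, x ≤ y →
      |Real.exp (min x c) - Real.exp (min y c)| ≤ Real.exp c * |x - y| := by
    intro x y hxy
    have h7 : min x c ≤ min y c := min_le_min_right c hxy
    rw [abs_sub_comm, abs_of_nonneg (sub_nonneg.2 (Real.exp_le_exp.2 h7)), abs_sub_comm x,
      abs_of_nonneg (sub_nonneg.2 hxy)]
    refine (h1 _ _ h7 (min_le_right _ _)).trans ?_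
    refine mul_le_mul_of_nonneg_left ?_ (Real.exp_pos c).le
    rcases le_total x c with h | h <;> rcases le_total y c with h' | h' <;> (simp [*]; try linarith)
  rcases le_total x y with h | h
  · exact h6 x y h
  · rw [abs_sub_comm, abs_sub_comm x]
    exact h6 y x h

/-- The integral form of the initial value problem has a unique continuous solution. -/
theorem existsUnique_eq_const_sub_radialOp_exp (k : ℕ) {A : C(Icc (0 : ℝ) 1, ℝ)} (hA : 0 ≤ A)
    (β : ℝ) : ∃! f, f = ContinuousMap.const _ β - radialOp k (A * expComp f) := by
  -- The nonlinearity truncated at `β`. Since `A ≥ 0`, solutions of either equation lie below `β`,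
  -- where the truncation has no effect, so both equations have the same solutions.
  set G : C(Icc (0 : ℝ) 1, ℝ) → C(Icc (0 : ℝ) 1, ℝ) := fun f =>
    A * expComp (f ⊓ ContinuousMap.const _ β) with hGdef
  have hG : ∀ f g r, |G f r - G g r| ≤ ‖A‖ * Real.exp β * |f r - g r| := by
    intro f g r
    have h1 : G f r - G g r = A r * (Real.exp (min (f r) β) - Real.exp (min (g r) β)) := by
      simp [hGdef, mul_sub]
    rw [h1, abs_mul, mul_assoc]
    exact mul_le_mul (A.norm_coe_le_norm r) (abs_exp_min_sub_le _ _ _) (abs_nonneg _)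
      (norm_nonneg _)
  have hle : ∀ f g, f = ContinuousMap.const _ β - radialOp k (A * expComp g) →
      G f = A * expComp f := by
    intro f g hf
    have : f ≤ ContinuousMap.const _ β := by
      rw [hf]
      exact sub_le_self _ (radialOp_nonneg k fun r => mul_nonneg (hA r) (Real.exp_pos _).le)
    simp only [hGdef, inf_eq_left.2 this]
  obtain ⟨f, hf, huniq⟩ := existsUnique_eq_sub_radialOp k (ContinuousMap.const _ β) G
    (by positivity) hG
  refine ⟨f, ?_, fun g hg => huniq g ?_⟩
  · have := hle f _ hf
    simp only at hf ⊢
    rw [← this]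
    exact hf
  · simp only
    rw [hle g g hg]
    exact hg

/-- The solution of the integral equation with initial value `β`. -/
noncomputable def volterraSol (k : ℕ) (A : C(Icc (0 : ℝ) 1, ℝ)) (β : ℝ) : C(Icc (0 : ℝ) 1, ℝ) :=
  Classical.epsilon fun f => f = ContinuousMap.const _ β - radialOp k (A * expComp f)

theorem volterraSol_eq (k : ℕ) {A : C(Icc (0 : ℝ) 1, ℝ)} (hA : 0 ≤ A) (β : ℝ) :
    volterraSol k A β =
      ContinuousMap.const _ β - radialOp k (A * expComp (volterraSol k A β)) :=
  Classical.epsilon_spec (existsUnique_eq_const_sub_radialOp_exp k hA β).exists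

theorem eq_volterraSol (k : ℕ) {A : C(Icc (0 : ℝ) 1, ℝ)} (hA : 0 ≤ A) {β : ℝ}
    {f : C(Icc (0 : ℝ) 1, ℝ)} (hf : f = ContinuousMap.const _ β - radialOp k (A * expComp f)) :
    f = volterraSol k A β :=
  (existsUnique_eq_const_sub_radialOp_exp k hA β).unique hf (volterraSol_eq k hA β)

/-! ### Analytic dependence on the initial value -/

/-- The map `w ↦ w + radialOp k (A e^w)`, whose value at the solution is the constant `β`. -/
noncomputable def volterraMap (k : ℕ) (A w : C(Icc (0 : ℝ) 1, ℝ)) : C(Icc (0 : ℝ) 1, ℝ) :=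
  w + radialOp k (A * NormedSpace.exp w)

theorem analyticAt_volterraMap (k : ℕ) (A w : C(Icc (0 : ℝ) 1, ℝ)) :
    AnalyticAt ℝ (volterraMap k A) w :=
  analyticAt_id.add (((radialOp k).analyticAt _).comp
    (analyticAt_const.mul (NormedSpace.exp_analytic (𝕂 := ℝ) w)))

/-- The derivative is `f ↦ f + radialOp k (A e^w f)`. Its bijectivity is the unique solvability of a
linear Volterra equation, and completeness of `C([0,1])` makes the inverse continuous. -/
theorem exists_hasFDerivAt_volterraMap (k : ℕ) (A w : C(Icc (0 : ℝ) 1, ℝ)) :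
    ∃ L : C(Icc (0 : ℝ) 1, ℝ) ≃L[ℝ] C(Icc (0 : ℝ) 1, ℝ),
      HasFDerivAt (volterraMap k A) (L : C(Icc (0 : ℝ) 1, ℝ) →L[ℝ] C(Icc (0 : ℝ) 1, ℝ)) w := by
  set M : C(Icc (0 : ℝ) 1, ℝ) →L[ℝ] C(Icc (0 : ℝ) 1, ℝ) :=
    A • (NormedSpace.exp w • (1 : C(Icc (0 : ℝ) 1, ℝ) →L[ℝ] C(Icc (0 : ℝ) 1, ℝ))) with hM
  have hMf : ∀ f, M f = A * (NormedSpace.exp w * f) := fun f => rfl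
  have hd : HasFDerivAt (volterraMap k A)
      (ContinuousLinearMap.id ℝ C(Icc (0 : ℝ) 1, ℝ) + (radialOp k).comp M) w :=
    (hasFDerivAt_id w).add ((radialOp k).hasFDerivAt.comp w
      ((hasStrictFDerivAt_exp (𝕂 := ℝ) (x := w)).hasFDerivAt.const_mul A))
  have hbij : Function.Bijective
      (ContinuousLinearMap.id ℝ C(Icc (0 : ℝ) 1, ℝ) + (radialOp k).comp M) := by
    rw [Function.bijective_iff_existsUnique]
    intro b
    have := existsUnique_eq_sub_radialOp k b M (C := ‖A * NormedSpace.exp w‖) (norm_nonneg _) ?_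
    · refine (existsUnique_congr fun f => ?_).1 this
      rw [eq_sub_iff_add_eq]
      rfl
    · intro f g r
      have h1 : M f r - M g r = (A * NormedSpace.exp w) r * (f r - g r) := by
        simp [hMf]; ring
      rw [h1, abs_mul]
      exact mul_le_mul_of_nonneg_right ((A * NormedSpace.exp w).norm_coe_le_norm r) (abs_nonneg _)
  refine ⟨ContinuousLinearEquiv.ofBijective _ (LinearMap.ker_eq_bot.2 hbij.1)
    (LinearMap.range_eq_top.2 hbij.2), ?_⟩
  rw [ContinuousLinearEquiv.coe_ofBijective]
  exact hd

/-- Near `β` the solution is the analytic local inverse of `volterraMap` evaluated at constant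
functions. -/
theorem analyticAt_volterraSol (k : ℕ) {A : C(Icc (0 : ℝ) 1, ℝ)} (hA : 0 ≤ A) (β : ℝ) :
    AnalyticAt ℝ (volterraSol k A) β := by
  set w := volterraSol k A β with hw
  have hsol : ∀ (f : C(Icc (0 : ℝ) 1, ℝ)) (c : ℝ), volterraMap k A f = ContinuousMap.const _ c ↔
      f = ContinuousMap.const _ c - radialOp k (A * expComp f) := by
    intro f c
    rw [eq_sub_iff_add_eq, expComp_eq_exp]
    rfl
  have hwβ : volterraMap k A w = ContinuousMap.const _ β := (hsol w β).2 (volterraSol_eq k hA β)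
  obtain ⟨L, hL⟩ := exists_hasFDerivAt_volterraMap k A w
  have han := analyticAt_volterraMap k A w
  have hstrict : HasStrictFDerivAt (volterraMap k A)
      (L : C(Icc (0 : ℝ) 1, ℝ) →L[ℝ] C(Icc (0 : ℝ) 1, ℝ)) w := by
    have := han.hasStrictFDerivAt
    rwa [hL.fderiv] at this
  set e := hstrict.toOpenPartialHomeomorph (volterraMap k A) with he
  have hcoe : (e : _ → _) = volterraMap k A := hstrict.toOpenPartialHomeomorph_coe
  have hwe : w ∈ e.source := hstrict.mem_toOpenPartialHomeomorph_source
  have hinv : AnalyticAt ℝ e.symm (ContinuousMap.const _ β) := by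
    have := e.analyticAt_symm' hwe
      (i := L) (by rw [hcoe]; exact han) (by rw [hcoe]; exact hL.fderiv)
    rwa [hcoe, hwβ] at this
  have hconst : AnalyticAt ℝ (fun c : ℝ => ContinuousMap.const (Icc (0 : ℝ) 1) c) β := by
    convert (ContinuousLinearMap.toSpanSingleton ℝ (1 : C(Icc (0 : ℝ) 1, ℝ))).analyticAt β using 1
    ext c r
    simp
  have hmem : ∀ᶠ c in 𝓝 β, ContinuousMap.const (Icc (0 : ℝ) 1) c ∈ e.target := by
    refine hconst.continuousAt.eventually (e.open_target.mem_nhds ?_)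
    beta_reduce
    rw [← hwβ, ← hcoe]
    exact e.map_source hwe
  refine (hinv.comp hconst).congr ?_
  -- Global uniqueness identifies the local inverse with the solution, so continuity of
  -- `volterraSol` in `β` need not be known beforehand.
  filter_upwards [hmem] with c hc
  refine eq_volterraSol k hA ((hsol _ c).1 ?_)
  rw [← hcoe]
  exact e.right_inv hc

theorem analyticAt_volterraSol_apply (k : ℕ) {A : C(Icc (0 : ℝ) 1, ℝ)} (hA : 0 ≤ A) (β : ℝ)
    (r : Icc (0 : ℝ) 1) : AnalyticAt ℝ (fun β => volterraSol k A β r) β :=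
  ((ContinuousMap.evalCLM ℝ r : C(Icc (0 : ℝ) 1, ℝ) →L[ℝ] ℝ).analyticAt
    (volterraSol k A β)).comp (analyticAt_volterraSol k hA β)

/-! ### Equivalence of the initial value problem and the integral equation -/

/-- The nonlinear source term `A e^v` of the solution with initial value `β`, extended to `ℝ`. -/
noncomputable def radialSource (k : ℕ) (A : C(Icc (0 : ℝ) 1, ℝ)) (β : ℝ) : ℝ → ℝ :=
  unitExtend (A * expComp (volterraSol k A β))

/-- The solution of the radial initial value problem in dimension `k + 1`, as a function on `ℝ`. -/
noncomputable def radialSol (k : ℕ) (A : C(Icc (0 : ℝ) 1, ℝ)) (β r : ℝ) : ℝ :=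
  β - radialPotential k (radialSource k A β) r

section RadialSol

variable {k : ℕ} {A : C(Icc (0 : ℝ) 1, ℝ)}

theorem continuous_radialSource (k : ℕ) (A : C(Icc (0 : ℝ) 1, ℝ)) (β : ℝ) :
    Continuous (radialSource k A β) := continuous_unitExtend _

theorem radialSol_zero (k : ℕ) (A : C(Icc (0 : ℝ) 1, ℝ)) (β : ℝ) : radialSol k A β 0 = β := by
  simp [radialSol]

theorem radialSol_eq_volterraSol (hA : 0 ≤ A) (β : ℝ) {r : ℝ} (hr : r ∈ Icc (0 : ℝ) 1) :
    radialSol k A β r = volterraSol k A β ⟨r, hr⟩ := by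
  rw [volterraSol_eq k hA β]
  rfl

theorem radialSource_eq (hA : 0 ≤ A) (β : ℝ) {r : ℝ} (hr : r ∈ Icc (0 : ℝ) 1) :
    radialSource k A β r = A ⟨r, hr⟩ * Real.exp (radialSol k A β r) := by
  rw [radialSource, unitExtend_of_mem _ hr, radialSol_eq_volterraSol hA β hr]
  rfl

theorem contDiff_radialSol (k : ℕ) (A : C(Icc (0 : ℝ) 1, ℝ)) (β : ℝ) :
    ContDiff ℝ 2 (radialSol k A β) :=
  contDiff_const.sub (contDiff_radialPotential k (continuous_radialSource k A β))

theorem hasDerivAt_radialSol (k : ℕ) (A : C(Icc (0 : ℝ) 1, ℝ)) (β r : ℝ) :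
    HasDerivAt (radialSol k A β) (-(r * radialMean k (radialSource k A β) r)) r :=
  (hasDerivAt_radialPotential k (continuous_radialSource k A β) r).const_sub β

theorem deriv_radialSol (k : ℕ) (A : C(Icc (0 : ℝ) 1, ℝ)) (β : ℝ) :
    deriv (radialSol k A β) = fun r => -(r * radialMean k (radialSource k A β) r) :=
  funext fun r => (hasDerivAt_radialSol k A β r).deriv

theorem isRadialIVPSolution_radialSol {a : ℝ → ℝ} (hA : 0 ≤ A)
    (hAa : ∀ r : Icc (0 : ℝ) 1, A r = a r) (β : ℝ) :
    IsRadialIVPSolution (k + 1) a β (radialSol k A β) where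
  contDiffOn := (contDiff_radialSol k A β).contDiffOn
  apply_zero := radialSol_zero k A β
  deriv_zero := by
    rw [(hasDerivAt_radialSol k A β 0).hasDerivWithinAt.derivWithin
      (uniqueDiffOn_Icc_zero_one 0 (by simp))]
    simp
  equation := by
    intro r hr
    have hr' : r ∈ Icc (0 : ℝ) 1 := ⟨hr.1.le, hr.2⟩
    rw [(hasDerivAt_radialSol k A β r).hasDerivWithinAt.derivWithin
      (uniqueDiffOn_Icc_zero_one r hr'),
      iteratedDerivWithin_eq_iteratedDeriv uniqueDiffOn_Icc_zero_one
        (contDiff_radialSol k A β).contDiffAt hr', iteratedDeriv_succ, iteratedDeriv_one,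
      deriv_radialSol]
    have h1 := (hasDerivAt_mul_radialMean k (continuous_radialSource k A β) r).neg.deriv
    have h2 : deriv (fun r => -(r * radialMean k (radialSource k A β) r)) r =
        -(radialSource k A β r - k * radialMean k (radialSource k A β) r) := h1
    have h3 : r ≠ 0 := hr.1.ne'
    rw [h2, ← hAa ⟨r, hr'⟩, ← radialSource_eq hA β hr']
    push_cast
    field_simp
    ring

theorem eq_apply_zero_of_hasDerivAt_zero {f : ℝ → ℝ} (hc : ContinuousOn f (Icc 0 1))
    (hd : ∀ r ∈ Ioo (0 : ℝ) 1, HasDerivAt f 0 r) {r : ℝ} (hr : r ∈ Icc (0 : ℝ) 1) :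
    f r = f 0 := by
  rcases hr.1.eq_or_lt with h | h
  · rw [← h]
  · obtain ⟨c, -, hc'⟩ := exists_hasDerivAt_eq_slope f (fun _ => 0) h
      (hc.mono (Icc_subset_Icc_right hr.2)) fun x hx => hd x ⟨hx.1, hx.2.trans_le hr.2⟩
    have : r - 0 ≠ 0 := by simpa using h.ne'
    field_simp at hc'
    linarith

/-- With `D = w' + r * radialMean k h r`, the equation says `(r^k D)' = 0`. As `r^k D` vanishes at
`0`, so does `D` on `(0,1]`, and `w + radialPotential k h` is constant. -/
theorem IsRadialIVPSolution.eq_sub_radialPotential {a w : ℝ → ℝ} {β : ℝ}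
    (hw : IsRadialIVPSolution (k + 1) a β w) {h : ℝ → ℝ} (hh : Continuous h)
    (hhw : ∀ r ∈ Icc (0 : ℝ) 1, h r = a r * Real.exp (w r)) {r : ℝ} (hr : r ∈ Icc (0 : ℝ) 1) :
    w r = β - radialPotential k h r := by
  have hI := uniqueDiffOn_Icc_zero_one
  have hwd : ∀ r ∈ Ioo (0 : ℝ) 1, HasDerivAt w (derivWithin w (Icc 0 1) r) r := fun r hr =>
    (hw.contDiffOn.differentiableOn (by simp) r
      (Ioo_subset_Icc_self hr)).hasDerivWithinAt.hasDerivAt (Icc_mem_nhds hr.1 hr.2)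
  have hw1 : ContDiffOn ℝ 1 (derivWithin w (Icc 0 1)) (Icc 0 1) :=
    hw.contDiffOn.derivWithin hI (by norm_num)
  have hwdd : ∀ r ∈ Ioo (0 : ℝ) 1, HasDerivAt (derivWithin w (Icc 0 1))
      (iteratedDerivWithin 2 w (Icc 0 1) r) r := fun r hr => by
    rw [iteratedDerivWithin_succ, iteratedDerivWithin_one]
    exact (hw1.differentiableOn (by simp) r
      (Ioo_subset_Icc_self hr)).hasDerivWithinAt.hasDerivAt (Icc_mem_nhds hr.1 hr.2)
  set D : ℝ → ℝ := fun r => derivWithin w (Icc 0 1) r + r * radialMean k h r with hD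
  have hDc : ContinuousOn D (Icc 0 1) :=
    hw1.continuousOn.add (continuous_id.mul (continuous_radialMean k hh)).continuousOn
  have hDzero : ∀ r ∈ Icc (0 : ℝ) 1, r ^ k * D r = 0 := by
    intro r hr
    rw [eq_apply_zero_of_hasDerivAt_zero (f := fun r => r ^ k * D r)
      ((continuous_pow k).continuousOn.mul hDc) ?_ hr]
    · simp [hD, hw.deriv_zero]
    · intro r hr
      have h1 := (hasDerivAt_pow k r).mul ((hwdd r hr).add (hasDerivAt_mul_radialMean k hh r))
      convert! h1 using 1
      have h2 := hw.equation r ⟨hr.1, hr.2.le⟩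
      rw [← hhw r (Ioo_subset_Icc_self hr)] at h2
      have h3 : iteratedDerivWithin 2 w (Icc 0 1) r =
          -h r - k / r * derivWithin w (Icc 0 1) r := by
        push_cast at h2
        rw [add_sub_cancel_right] at h2
        linarith
      have h4 : r ≠ 0 := hr.1.ne'
      rw [h3]
      -- The derivative of `r ^ k` carries the truncated exponent `k - 1`, so `k = 0` is treated
      -- apart.
      rcases k with _ | j
      · simp
      · simp only [Pi.add_apply, Nat.add_sub_cancel, pow_succ]
        field_simp
        ring
  have hconst := eq_apply_zero_of_hasDerivAt_zero (f := fun r => w r + radialPotential k h r)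
    (hw.contDiffOn.continuousOn.add (contDiff_radialPotential k hh).continuous.continuousOn) ?_ hr
  · simp only [hw.apply_zero, radialPotential_zero, add_zero] at hconst
    linarith
  · intro r hr
    have h1 := (hwd r hr).add (hasDerivAt_radialPotential k hh r)
    have h2 : D r = 0 :=
      (mul_eq_zero.1 (hDzero r (Ioo_subset_Icc_self hr))).resolve_left (pow_ne_zero _ hr.1.ne')
    rw [← h2]
    exact h1

theorem IsRadialIVPSolution.eqOn_radialSol {a w : ℝ → ℝ} {β : ℝ} (hA : 0 ≤ A)
    (hAa : ∀ r : Icc (0 : ℝ) 1, A r = a r) (hw : IsRadialIVPSolution (k + 1) a β w) :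
    EqOn w (radialSol k A β) (Icc 0 1) := by
  intro r hr
  set f : C(Icc (0 : ℝ) 1, ℝ) := ⟨fun r => w r, hw.contDiffOn.continuousOn.domRestrict⟩ with hf
  have hh : ∀ r ∈ Icc (0 : ℝ) 1, unitExtend (A * expComp f) r = a r * Real.exp (w r) := by
    intro r hr
    rw [unitExtend_of_mem _ hr, ← hAa ⟨r, hr⟩]
    rfl
  have hfs : f = volterraSol k A β := by
    refine eq_volterraSol k hA ?_
    ext r
    exact hw.eq_sub_radialPotential (continuous_unitExtend _) hh r.2
  rw [radialSol_eq_volterraSol hA β hr, ← hfs]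
  rfl

/-! ### Monotonicity and a priori bounds -/

theorem radialSource_nonneg (hA : 0 ≤ A) (β : ℝ) {r : ℝ} (hr : r ∈ Icc (0 : ℝ) 1) :
    0 ≤ radialSource k A β r := by
  rw [radialSource_eq hA β hr]
  exact mul_nonneg (hA _) (Real.exp_pos _).le

theorem radialSol_antitoneOn (hA : 0 ≤ A) (β : ℝ) :
    AntitoneOn (radialSol k A β) (Icc 0 1) := by
  refine antitoneOn_of_deriv_nonpos (convex_Icc 0 1)
    (contDiff_radialSol k A β).continuous.continuousOn
    (fun r _ => (hasDerivAt_radialSol k A β r).differentiableAt.differentiableWithinAt) ?_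
  intro r hr
  rw [interior_Icc] at hr
  rw [deriv_radialSol]
  have h1 := radialMean_mono_left (k := k) (continuous_radialSource k A β)
    (continuous_const (y := (0 : ℝ))) hr.1.le
    fun t ht => radialSource_nonneg hA β ⟨ht.1, ht.2.trans hr.2.le⟩
  rw [radialMean_const, zero_div] at h1
  have := mul_nonneg hr.1.le h1
  simp only
  linarith

/-- As the solution decreases, the source on `[0,r]` is at least the constant `m e^{v(r)}`, whose
mean carries the factor `1 / (k + 1)`. -/
theorem le_radialMean_radialSource (hA : 0 ≤ A) {m : ℝ} (hm : 0 ≤ m) (hmA : ∀ r, m ≤ A r) (β : ℝ)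
    {r : ℝ} (hr : r ∈ Icc (0 : ℝ) 1) :
    m * Real.exp (radialSol k A β r) / (k + 1) ≤ radialMean k (radialSource k A β) r := by
  rw [← radialMean_const k _ r]
  refine radialMean_mono_left (continuous_radialSource k A β) continuous_const hr.1 fun t ht => ?_
  have ht' : t ∈ Icc (0 : ℝ) 1 := ⟨ht.1, ht.2.trans hr.2⟩
  rw [radialSource_eq hA β ht']
  exact mul_le_mul (hmA _) (Real.exp_le_exp.2 (radialSol_antitoneOn hA β ht' hr ht.2))
    (Real.exp_pos _).le (hm.trans (hmA _))

theorem radialSol_strictAntiOn (hA : 0 ≤ A) {m : ℝ} (hm : 0 < m) (hmA : ∀ r, m ≤ A r) (β : ℝ) :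
    StrictAntiOn (radialSol k A β) (Icc 0 1) := by
  refine strictAntiOn_of_deriv_neg (convex_Icc 0 1)
    (contDiff_radialSol k A β).continuous.continuousOn ?_
  intro r hr
  rw [interior_Icc] at hr
  rw [deriv_radialSol]
  have h1 := le_radialMean_radialSource (k := k) hA hm.le hmA β (Ioo_subset_Icc_self hr)
  have h2 : 0 < m * Real.exp (radialSol k A β r) / (k + 1) := by positivity
  have := mul_pos hr.1 (h2.trans_le h1)
  simp only
  linarith

/-- The lower bound on the mean gives `(e^{-v})' ≥ m r / (k + 1)`, so `e^{-v(1)} ≥ m / (2 (k + 1))`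
independently of `β`. -/
theorem exp_radialSol_one_le (hA : 0 ≤ A) {m : ℝ} (hm : 0 < m) (hmA : ∀ r, m ≤ A r) (β : ℝ) :
    Real.exp (radialSol k A β 1) ≤ 2 * (k + 1) / m := by
  have hd : ∀ r, HasDerivAt (fun r => Real.exp (-radialSol k A β r) - m / (k + 1) * (r ^ 2 / 2))
      (Real.exp (-radialSol k A β r) * (r * radialMean k (radialSource k A β) r)
        - m / (k + 1) * r) r := by
    intro r
    convert! (hasDerivAt_radialSol k A β r).neg.exp.sub
      (((hasDerivAt_pow 2 r).div_const 2).const_mul (m / (k + 1))) using 1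
    simp
  have hmono : MonotoneOn (fun r => Real.exp (-radialSol k A β r) - m / (k + 1) * (r ^ 2 / 2))
      (Icc 0 1) := by
    refine monotoneOn_of_deriv_nonneg (convex_Icc 0 1)
      (fun r _ => (hd r).continuousAt.continuousWithinAt)
      (fun r _ => (hd r).differentiableAt.differentiableWithinAt) ?_
    intro r hr
    rw [interior_Icc] at hr
    rw [(hd r).deriv]
    have h1 := le_radialMean_radialSource (k := k) hA hm.le hmA β (Ioo_subset_Icc_self hr)
    have h2 := mul_le_mul_of_nonneg_left (mul_le_mul_of_nonneg_left h1 hr.1.le)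
      (Real.exp_pos (-radialSol k A β r)).le
    have h3 : Real.exp (-radialSol k A β r) * (r * (m * Real.exp (radialSol k A β r) / (k + 1)))
        = m / (k + 1) * r := by
      rw [Real.exp_neg]
      field_simp
    linarith
  have h1 := hmono (left_mem_Icc.2 zero_le_one) (right_mem_Icc.2 zero_le_one) zero_le_one
  have h2 := Real.exp_pos (-radialSol k A β 0)
  have h3 : m / (k + 1) / 2 ≤ Real.exp (-radialSol k A β 1) := by
    norm_num at h1
    linarith
  rw [Real.exp_neg] at h3
  have h4 : 0 < m / (k + 1) / 2 := by positivity
  have h5 := inv_anti₀ h4 h3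
  rw [inv_inv] at h5
  refine h5.trans (le_of_eq ?_)
  field_simp

/-- Since `v ≤ β`, the source is at most `‖A‖ e^β`. This forces `α(β) → 0` as `β → -∞`. -/
theorem sub_radialSol_one_le (hA : 0 ≤ A) (β : ℝ) :
    β - radialSol k A β 1 ≤ ‖A‖ * Real.exp β := by
  have h1 := abs_radialPotential_le k 0 (h := radialSource k A β) (r := 1)
    (C := ‖A‖ * Real.exp β) zero_le_one le_rfl (by positivity) ?_
  · simp only [one_pow, zero_add, Nat.factorial_one, Nat.cast_one, div_one, mul_one] at h1
    rw [radialSol, sub_sub_cancel]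
    exact (le_abs_self _).trans h1
  · intro t ht
    rw [abs_of_nonneg (radialSource_nonneg hA β ht), radialSource_eq hA β ht]
    simp only [pow_zero, Nat.factorial_zero, Nat.cast_one, div_one, mul_one]
    have h2 := radialSol_antitoneOn (k := k) hA β (left_mem_Icc.2 zero_le_one) ht ht.1
    rw [radialSol_zero] at h2
    exact mul_le_mul ((le_abs_self _).trans (A.norm_coe_le_norm _)) (Real.exp_le_exp.2 h2)
      (Real.exp_pos _).le (norm_nonneg _)

/-! ### Correspondence with radial solutions of the PDE -/

theorem branchLambda_radialSol (β : ℝ) :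
    branchLambda (radialSol k A) β = Real.exp (radialSol k A β 1) := rfl

theorem branchAlpha_radialSol (β : ℝ) :
    branchAlpha (radialSol k A) β = β - radialSol k A β 1 := by
  rw [branchAlpha, branchLambda_radialSol, Real.log_exp]

theorem branchFun_radialSol (β : ℝ) : branchFun (k + 1) (radialSol k A) β = fun x =>
    (β - radialSol k A β 1) - radialPotential k (radialSource k A β) ‖x‖ := by
  ext x
  rw [branchFun, branchLambda_radialSol, Real.log_exp]
  simp only [radialSol]
  ring

theorem branchFun_radialSol_apply (β : ℝ) (x : EuclideanSpace ℝ (Fin (k + 1))) :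
    branchFun (k + 1) (radialSol k A) β x = radialSol k A β ‖x‖ - radialSol k A β 1 := by
  rw [branchFun, branchLambda_radialSol, Real.log_exp]

theorem contDiff_branchFun_radialSol (β : ℝ) :
    ContDiff ℝ 2 (branchFun (k + 1) (radialSol k A) β) := by
  rw [branchFun_radialSol]
  exact contDiff_const.sub (contDiff_radialPotential_norm k (continuous_radialSource k A β))

theorem laplacian_branchFun_radialSol (β : ℝ) (x : EuclideanSpace ℝ (Fin (k + 1))) :
    (Δ (branchFun (k + 1) (radialSol k A) β)) x = -radialSource k A β ‖x‖ := by
  rw [branchFun_radialSol]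
  have h1 : ContDiffAt ℝ 2 (fun _ : EuclideanSpace ℝ (Fin (k + 1)) => β - radialSol k A β 1) x :=
    contDiffAt_const
  have h2 := (contDiff_radialPotential_norm (F := EuclideanSpace ℝ (Fin (k + 1))) k
    (continuous_radialSource k A β)).contDiffAt (x := x)
  have h3 := h1.laplacian_sub h2
  rw [InnerProductSpace.laplacian_const,
    laplacian_radialPotential_norm (by simp) (continuous_radialSource k A β)] at h3
  rw [Pi.zero_apply, zero_sub] at h3
  exact h3

theorem isRadialGelfandSolution_of_eqOn {a : ℝ → ℝ} (hA : 0 ≤ A)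
    (hAa : ∀ r : Icc (0 : ℝ) 1, A r = a r) {m : ℝ} (hm : 0 < m) (hmA : ∀ r, m ≤ A r) {β : ℝ}
    {u : EuclideanSpace ℝ (Fin (k + 1)) → ℝ}
    (hu : EqOn u (branchFun (k + 1) (radialSol k A) β) (Metric.closedBall 0 1)) :
    IsRadialGelfandSolution (k + 1) a (branchLambda (radialSol k A) β) u := by
  have hub : EqOn u (branchFun (k + 1) (radialSol k A) β) (Metric.ball 0 1) :=
    hu.mono Metric.ball_subset_closedBall
  refine ⟨Real.exp_pos _, ((contDiff_branchFun_radialSol β).contDiffOn).congr hub,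
    ((contDiff_branchFun_radialSol β).continuous.continuousOn).congr hu, ?_, ?_, ?_, ?_⟩
  · intro x hx y hy hxy
    rw [hu hx, hu hy, branchFun_radialSol_apply, branchFun_radialSol_apply, hxy]
  · intro x hx
    have hx' : ‖x‖ ∈ Icc (0 : ℝ) 1 := ⟨norm_nonneg x, (mem_ball_zero_iff.1 hx).le⟩
    have h1 : u =ᶠ[𝓝 x] branchFun (k + 1) (radialSol k A) β :=
      hub.eventuallyEq_of_mem (Metric.isOpen_ball.mem_nhds hx)
    rw [(InnerProductSpace.laplacian_congr_nhds h1).eq_of_nhds, laplacian_branchFun_radialSol,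
      neg_neg, radialSource_eq hA β hx', hub hx, branchFun_radialSol_apply, branchLambda_radialSol,
      Real.exp_sub, hAa ⟨‖x‖, hx'⟩]
    field_simp
  · intro x hx
    rw [hub hx, branchFun_radialSol_apply, sub_pos]
    have hx1 := mem_ball_zero_iff.1 hx
    exact radialSol_strictAntiOn hA hm hmA β ⟨norm_nonneg x, hx1.le⟩
      (right_mem_Icc.2 zero_le_one) hx1
  · intro x hx
    rw [hu (Metric.sphere_subset_closedBall hx), branchFun_radialSol_apply,
      mem_sphere_zero_iff_norm.1 hx, sub_self]

/-- Adding to `u` the potential of its own right-hand side gives a harmonic function, constant on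
the sphere and hence on the ball. The integral equation follows without passing through an ODE for
the radial profile or its regularity at the origin. -/
theorem IsRadialGelfandSolution.exists_eqOn_branchFun {a : ℝ → ℝ} {lam : ℝ}
    {u : EuclideanSpace ℝ (Fin (k + 1)) → ℝ} (hA : 0 ≤ A)
    (hAa : ∀ r : Icc (0 : ℝ) 1, A r = a r) (hu : IsRadialGelfandSolution (k + 1) a lam u) :
    ∃ β : ℝ, lam = branchLambda (radialSol k A) β ∧
      EqOn u (branchFun (k + 1) (radialSol k A) β) (Metric.closedBall 0 1) := by
  set e : EuclideanSpace ℝ (Fin (k + 1)) := EuclideanSpace.single 0 1 with he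
  have hnorm : ∀ r ∈ Icc (0 : ℝ) 1, ‖r • e‖ = r := fun r hr => by
    simp [he, norm_smul, abs_of_nonneg hr.1]
  have hmem : ∀ r ∈ Icc (0 : ℝ) 1, r • e ∈ Metric.closedBall 0 1 := fun r hr => by
    rw [mem_closedBall_zero_iff, hnorm r hr]
    exact hr.2
  set V : C(Icc (0 : ℝ) 1, ℝ) := ⟨fun r => u ((r : ℝ) • e),
    hu.continuousOn.comp_continuous (by fun_prop) fun r => hmem r r.2⟩ with hV
  have huV : ∀ x (hx : ‖x‖ ∈ Icc (0 : ℝ) 1), u x = V ⟨‖x‖, hx⟩ := fun x hx =>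
    hu.radial x (mem_closedBall_zero_iff.2 hx.2) _ (hmem _ hx) (hnorm _ hx).symm
  -- The shift by `log lam` absorbs the parameter: `A e^f = lam A e^V`.
  set f : C(Icc (0 : ℝ) 1, ℝ) := V + ContinuousMap.const _ (Real.log lam) with hf
  set h := unitExtend (A * expComp f) with hh
  have hhc : Continuous h := continuous_unitExtend _
  set U : EuclideanSpace ℝ (Fin (k + 1)) → ℝ := fun x => radialPotential k h ‖x‖ with hU
  have hUd : ContDiff ℝ 2 U := contDiff_radialPotential_norm k hhc
  have hlap : ∀ x ∈ Metric.ball (0 : EuclideanSpace ℝ (Fin (k + 1))) 1, (Δ (u + U)) x = 0 := by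
    intro x hx
    have hx' : ‖x‖ ∈ Icc (0 : ℝ) 1 := ⟨norm_nonneg x, (mem_ball_zero_iff.1 hx).le⟩
    rw [(hu.contDiffOn.contDiffAt (Metric.isOpen_ball.mem_nhds hx)).laplacian_add hUd.contDiffAt,
      hU, laplacian_radialPotential_norm (by simp) hhc, hh, unitExtend_of_mem _ hx']
    have h1 := hu.equation x hx
    rw [huV x hx', ← hAa ⟨‖x‖, hx'⟩] at h1
    rw [ContinuousMap.mul_apply, expComp_apply, hf, ContinuousMap.add_apply,
      ContinuousMap.const_apply, Real.exp_add, Real.exp_log hu.lam_pos]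
    linarith
  have hd : ContDiffOn ℝ 2 (u + U) (Metric.ball 0 1) := hu.contDiffOn.add hUd.contDiffOn
  have hc : ContinuousOn (u + U) (Metric.closedBall 0 1) :=
    hu.continuousOn.add hUd.continuous.continuousOn
  set c := radialPotential k h 1 with hcdef
  have hsph : ∀ x ∈ Metric.sphere (0 : EuclideanSpace ℝ (Fin (k + 1))) 1, (u + U) x = c := by
    intro x hx
    rw [Pi.add_apply, hu.boundary x hx, zero_add, hU, hcdef, ← mem_sphere_zero_iff_norm.1 hx]
  have hconst : ∀ x ∈ Metric.closedBall (0 : EuclideanSpace ℝ (Fin (k + 1))) 1,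
      u x = c - radialPotential k h ‖x‖ := by
    intro x hx
    have h1 : (u + U) x ≤ c := le_of_laplacian_nonneg_ball hc hd (fun y hy => (hlap y hy).ge)
      (fun y hy => (hsph y hy).le) hx
    have h2 : (-(u + U)) x ≤ -c := le_of_laplacian_nonneg_ball hc.neg hd.neg
      (fun y hy => by rw [InnerProductSpace.laplacian_neg, Pi.neg_apply, hlap y hy, neg_zero])
      (fun y hy => by rw [Pi.neg_apply, hsph y hy]) hx
    simp only [Pi.add_apply, Pi.neg_apply, hU] at h1 h2
    linarith
  have hfs : f = volterraSol k A (c + Real.log lam) := by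
    refine eq_volterraSol k hA ?_
    ext r
    have h1 : V r = c - radialPotential k h r := by
      have := hconst _ (hmem r r.2)
      rwa [hnorm r r.2] at this
    have h2 : radialOp k (A * expComp f) r = radialPotential k h r := rfl
    rw [ContinuousMap.sub_apply, h2, hf, ContinuousMap.add_apply, h1]
    simp only [ContinuousMap.const_apply]
    ring
  have hsol : ∀ r (hr : r ∈ Icc (0 : ℝ) 1),
      radialSol k A (c + Real.log lam) r = V ⟨r, hr⟩ + Real.log lam := by
    intro r hr
    rw [radialSol_eq_volterraSol hA _ hr, ← hfs]
    rfl
  have h1mem : (1 : ℝ) ∈ Icc (0 : ℝ) 1 := right_mem_Icc.2 zero_le_one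
  have hsol1 : radialSol k A (c + Real.log lam) 1 = Real.log lam := by
    rw [hsol 1 h1mem]
    have : V ⟨1, h1mem⟩ = 0 :=
      hu.boundary _ (mem_sphere_zero_iff_norm.2 (hnorm 1 h1mem))
    rw [this, zero_add]
  refine ⟨c + Real.log lam, ?_, ?_⟩
  · rw [branchLambda_radialSol, hsol1, Real.exp_log hu.lam_pos]
  · intro x hx
    have hx' : ‖x‖ ∈ Icc (0 : ℝ) 1 := ⟨norm_nonneg x, mem_closedBall_zero_iff.1 hx⟩
    rw [branchFun_radialSol_apply, hsol1, hsol _ hx', huV x hx']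
    ring

end RadialSol

/-! ### Sup norm, continuity of the weight, and the main theorem -/

/-- The `L^∞` norm over an open set of a continuous function is any attained bound. -/
theorem eLpNorm_top_restrict_eq_of_isMaxOn {X : Type*} [TopologicalSpace X] [MeasurableSpace X]
    [OpensMeasurableSpace X] {μ : Measure X} [μ.IsOpenPosMeasure] {f : X → ℝ} (hf : Continuous f)
    {s : Set X} (hs : IsOpen s) {x : X} (hx : x ∈ s) (hmax : ∀ y ∈ s, ‖f y‖ ≤ ‖f x‖) :
    eLpNorm f ⊤ (μ.restrict s) = ‖f x‖ₑ := by
  rw [eLpNorm_exponent_top]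
  refine le_antisymm ?_ ?_
  · refine essSup_le_of_ae_le _ ?_
    filter_upwards [ae_restrict_mem hs.measurableSet] with y hy
    exact enorm_le_iff_norm_le.2 (hmax y hy)
  -- Otherwise the part of `s` where `‖f‖` exceeds its essential supremum is open and contains `x`,
  -- so it has positive measure.
  · by_contra! hlt
    have h1 := (ae_restrict_iff' hs.measurableSet).1
      (enorm_ae_le_eLpNormEssSup f (μ.restrict s))
    have ho : IsOpen (s ∩ {y | eLpNormEssSup f (μ.restrict s) < ‖f y‖ₑ}) :=
      hs.inter (isOpen_lt continuous_const hf.enorm)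
    refine (ho.measure_pos μ ⟨x, hx, hlt⟩).ne' ?_
    refine measure_mono_null ?_ h1
    intro y hy
    simpa using hy

theorem IsGelfandWeight.continuousOn {k : ℕ} {a : ℝ → ℝ} (ha : IsGelfandWeight (k + 1) a) :
    ContinuousOn a (Icc 0 1) := by
  set e : EuclideanSpace ℝ (Fin (k + 1)) := EuclideanSpace.single 0 1 with he
  have hnorm : ∀ r ∈ Icc (0 : ℝ) 1, ‖r • e‖ = r := fun r hr => by
    simp [he, norm_smul, abs_of_nonneg hr.1]
  have h1 : ContinuousOn (fun r : ℝ => a ‖r • e‖) (Icc 0 1) :=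
    ha.contDiffOn.continuousOn.comp (f := fun r : ℝ => r • e) (by fun_prop) fun r hr => by
      rw [mem_closedBall_zero_iff, hnorm r hr]
      exact hr.2
  exact h1.congr fun r hr => by simp only [hnorm r hr]

theorem theorem1p1 (N : ℕ) (hN : 3 ≤ N) (a : ℝ → ℝ) (ha : IsGelfandWeight N a) :
    ∃ v : ℝ → ℝ → ℝ,
      -- `v β` is the unique solution of the initial value problem with initial value `β`
      (∀ β : ℝ, IsRadialIVPSolution N a β (v β) ∧
        ∀ w : ℝ → ℝ, IsRadialIVPSolution N a β w → EqOn w (v β) (Icc 0 1)) ∧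
      -- the radial solutions are exactly the pairs `(λ(β), u(·, α(β)))`
      (∀ (lam : ℝ) (u : EuclideanSpace ℝ (Fin N) → ℝ),
        IsRadialGelfandSolution N a lam u ↔
          ∃ β : ℝ, lam = branchLambda v β ∧
            EqOn u (branchFun N v β) (Metric.closedBall 0 1)) ∧
      -- `α(β)` is the `L^∞` norm of the solution
      (∀ β : ℝ, 0 < branchAlpha v β ∧
        eLpNorm (branchFun N v β) ⊤ (volume.restrict (Metric.ball 0 1))
          = ENNReal.ofReal (branchAlpha v β)) ∧
      -- the branch is a regular, injectively parametrized analytic curve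
      AnalyticOnNhd ℝ (branchCurve v) univ ∧
      (∀ β : ℝ, deriv (branchCurve v) β ≠ 0) ∧
      Function.Injective (branchCurve v) ∧
      -- it emanates from `(0,0)` and is unbounded
      Tendsto (branchCurve v) atBot (𝓝 (0, 0)) ∧
      ¬ Bornology.IsBounded (range (branchCurve v)) ∧
      -- `λ` is bounded above
      ∃ lamStar : ℝ, 0 < lamStar ∧ ∀ β : ℝ, branchLambda v β ≤ lamStar := by
  obtain ⟨k, rfl⟩ : ∃ k, N = k + 1 := ⟨N - 1, by omega⟩
  set A : C(Icc (0 : ℝ) 1, ℝ) := ⟨fun r => a r, ha.continuousOn.domRestrict⟩ with hAdef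
  have hAa : ∀ r : Icc (0 : ℝ) 1, A r = a r := fun r => rfl
  obtain ⟨m, hm, hmA⟩ : ∃ m, 0 < m ∧ ∀ r, m ≤ A r := by
    obtain ⟨r, hr, hmin⟩ := isCompact_Icc.exists_isMinOn (nonempty_Icc.2 zero_le_one)
      ha.continuousOn
    exact ⟨a r, ha.pos r hr, fun t => hmin t.2⟩
  have hA : 0 ≤ A := fun r => hm.le.trans (hmA r)
  have h0mem : (0 : ℝ) ∈ Icc (0 : ℝ) 1 := left_mem_Icc.2 zero_le_one
  have h1mem : (1 : ℝ) ∈ Icc (0 : ℝ) 1 := right_mem_Icc.2 zero_le_one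
  have hlt : ∀ β, radialSol k A β 1 < β := fun β => by
    simpa only [radialSol_zero] using radialSol_strictAntiOn hA hm hmA β h0mem h1mem zero_lt_one
  have han1 : ∀ β, AnalyticAt ℝ (fun β => radialSol k A β 1) β := fun β => by
    simp only [radialSol_eq_volterraSol hA _ h1mem]
    exact analyticAt_volterraSol_apply k hA β _
  have hanL : ∀ β, AnalyticAt ℝ (branchLambda (radialSol k A)) β := fun β => (han1 β).rexp
  have hanA : ∀ β, AnalyticAt ℝ (branchAlpha (radialSol k A)) β := fun β =>
    (analyticAt_id.sub (han1 β)).congr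
      (Eventually.of_forall fun β => (branchAlpha_radialSol β).symm)
  have hbound : ∀ β, branchLambda (radialSol k A) β ≤ 2 * (k + 1) / m := fun β =>
    exp_radialSol_one_le hA hm hmA β
  refine ⟨radialSol k A, fun β => ⟨isRadialIVPSolution_radialSol hA hAa β,
    fun w hw => hw.eqOn_radialSol hA hAa⟩, fun lam u => ⟨fun hu => hu.exists_eqOn_branchFun hA hAa,
    ?_⟩, fun β => ⟨?_, ?_⟩, fun β _ => (hanL β).prod (hanA β), fun β => ?_, ?_, ?_, ?_,
    2 * (k + 1) / m, by positivity, hbound⟩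
  · rintro ⟨β, rfl, hu⟩
    exact isRadialGelfandSolution_of_eqOn hA hAa hm hmA hu
  · rw [branchAlpha_radialSol, sub_pos]
    exact hlt β
  · have hval : ∀ y ∈ Metric.ball (0 : EuclideanSpace ℝ (Fin (k + 1))) 1,
        ‖branchFun (k + 1) (radialSol k A) β y‖ = radialSol k A β ‖y‖ - radialSol k A β 1 := by
      intro y hy
      have hy' : ‖y‖ ∈ Icc (0 : ℝ) 1 := ⟨norm_nonneg y, (mem_ball_zero_iff.1 hy).le⟩
      rw [branchFun_radialSol_apply, Real.norm_of_nonneg]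
      exact sub_nonneg.2 (radialSol_antitoneOn hA β hy' h1mem hy'.2)
    have h0 : (0 : EuclideanSpace ℝ (Fin (k + 1))) ∈ Metric.ball 0 1 := by simp
    rw [eLpNorm_top_restrict_eq_of_isMaxOn (contDiff_branchFun_radialSol β).continuous
      Metric.isOpen_ball h0, ← ofReal_norm, hval 0 h0, norm_zero, radialSol_zero,
      branchAlpha_radialSol]
    intro y hy
    rw [hval y hy, hval 0 h0, norm_zero]
    exact sub_le_sub_right (radialSol_antitoneOn hA β h0mem
      ⟨norm_nonneg y, (mem_ball_zero_iff.1 hy).le⟩ (norm_nonneg y)) _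
  · intro h0
    have hL := (hanL β).differentiableAt.hasDerivAt
    have hAl := (hanA β).differentiableAt.hasDerivAt
    have hpair := (hL.prodMk hAl).deriv
    rw [show (fun β => (branchLambda (radialSol k A) β, branchAlpha (radialSol k A) β)) =
      branchCurve (radialSol k A) from rfl, h0, Prod.ext_iff] at hpair
    have hL0 : deriv (branchLambda (radialSol k A)) β = 0 := hpair.1.symm
    have hA0 : deriv (branchAlpha (radialSol k A)) β = 0 := hpair.2.symm
    rw [hL0] at hL
    -- From `α = β - log λ`, the vanishing of `λ'` forces `α' = 1`, so both derivatives cannot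
    -- vanish together.
    have h1 := ((hasDerivAt_id β).sub (hL.log (Real.exp_pos _).ne')).deriv
    rw [zero_div, sub_zero] at h1
    exact one_ne_zero (h1.symm.trans hA0)
  · intro β γ hβγ
    obtain ⟨h1, h2⟩ := Prod.ext_iff.1 hβγ
    simp only [branchCurve, branchAlpha] at h1 h2
    rw [h1] at h2
    exact sub_left_injective h2
  · refine Tendsto.prodMk_nhds ?_ ?_
    · refine squeeze_zero (fun β => (Real.exp_pos _).le) (fun β => ?_) Real.tendsto_exp_atBot
      exact Real.exp_le_exp.2 (hlt β).le
    · refine squeeze_zero (g := fun β => ‖A‖ * Real.exp β) (fun β => ?_) (fun β => ?_) ?_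
      · rw [branchAlpha_radialSol, sub_nonneg]
        exact (hlt β).le
      · rw [branchAlpha_radialSol]
        exact sub_radialSol_one_le hA β
      · simpa using Real.tendsto_exp_atBot.const_mul ‖A‖
  · intro hb
    obtain ⟨C, hC⟩ := isBounded_iff_forall_norm_le.1 hb
    -- For this `β`, `α(β) = β - log λ(β) ≥ C + 1`, because `λ(β) ≤ 2 (k + 1) / m`.
    set β := C + 1 + Real.log (2 * (k + 1) / m) with hβ
    have h1 := (norm_snd_le _).trans (hC _ (mem_range_self β))
    have h2 : branchAlpha (radialSol k A) β ≤ C := (le_abs_self _).trans h1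
    have h3 : Real.log (branchLambda (radialSol k A) β) ≤ Real.log (2 * (k + 1) / m) :=
      Real.log_le_log (Real.exp_pos _) (hbound β)
    rw [branchAlpha] at h2
    linarith
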